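/- Let $d\ge 1$ and let $0\le t\le d$ be integers. Let $\mathcal G_{1,d}=\{P\in\mathbb R^{d\times d}: P^\top=P,\ P^2=P,\ \operatorname{trace}(P)=1\}$ be the set of rank-one orthogonal projectors on $\mathbb R^d$, let $\sigma_{1,d}$ be the orthogonally invariant probability measure on $\mathcal G_{1,d}$ (the image of the Haar probability measure of $\mathcal O(d)$ under $U\mapsto U D_1U^\top$, where $D_1=\operatorname{diag}(1,0,\dots,0)$), and let $$\mathrm{Pol}^3_t(\mathcal G_{1,d})=\operatorname{span}\{P\mapsto \operatorname{trace}(MP)^s : M\in\mathbb R^{d\times d},\ M^\top=M,\ \operatorname{rank}(M)\le 3,\ s\in\mathbb N_0,\ s\le t\}.$$ Let $P_1,\dots,P_n\in\mathcal G_{1,d}$ and $\omega_1,\dots,\omega_n\in\mathbb R$ be such that $\{(P_j,\omega_j)\}_{j=1}^n$ is a cubature for $\mathrm{Pol}^3_t(\mathcal G_{1,d})$, i.e. $$\sum_{j=1}^n\omega_j f(P_j)=\int_{\mathcal G_{1,d}}f(P)\,d\sigma_{1,d}(P)\qquad\text{for all } f\in \mathrm{Pol}^3_t(\mathcal G_{1,d}).$$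 Then for every multi-index $\alpha\in\mathbb N_0^d$ with $|\alpha|=t$ there are coefficients $a^\alpha_\beta\in\mathbb R$ ($\beta\in\mathbb N_0^d$, $|\beta|=t$) such that, for every random vector $X$ in $\mathbb R^d$ whose projected moments $\mathbb E(P_jX)^\beta$ ($1\le j\le n$, $|\beta|=t$) all exist as absolutely convergent expectations, the moment $\mathbb E X^\alpha$ also exists as an absolutely convergent expectation, and $$\mathbb E X^\alpha=\sum_{|\beta|=t}a^\alpha_\beta\sum_{j=1}^n\omega_j\,\mathbb E(P_jX)^\beta .$$ -/

import Mathlib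

open MeasureTheory

namespace MomentFusion

noncomputable section

/-- The Grassmann space `𝒢_{k,d}`: the rank-`k` orthogonal projectors on `ℝ^d`, that is, the
real symmetric idempotent `d × d` matrices of trace `k`. -/
def grassmannian (k d : ℕ) : Set (Matrix (Fin d) (Fin d) ℝ) :=
  {P | P.IsSymm ∧ P * P = P ∧ P.trace = (k : ℝ)}

instance (k d : ℕ) : MeasurableSpace (grassmannian k d) := borel _

instance (k d : ℕ) : BorelSpace (grassmannian k d) := ⟨rfl⟩

instance (d : ℕ) : MeasurableSpace (Matrix.orthogonalGroup (Fin d) ℝ) := borel _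

instance (d : ℕ) : BorelSpace (Matrix.orthogonalGroup (Fin d) ℝ) := ⟨rfl⟩

instance (d : ℕ) : CompactSpace (Matrix.orthogonalGroup (Fin d) ℝ) := by
  apply isCompact_iff_compactSpace.mp
  have hc : IsCompact (Set.pi Set.univ fun _ : Fin d => Set.pi Set.univ fun _ : Fin d =>
      Set.Icc (-1 : ℝ) 1) :=
    isCompact_univ_pi fun _ => isCompact_univ_pi fun _ => isCompact_Icc
  refine IsCompact.of_isClosed_subset (s := (_ : Set (Matrix (Fin d) (Fin d) ℝ))) hc ?_ ?_
  · have : ((Matrix.orthogonalGroup (Fin d) ℝ : Set (Matrix (Fin d) (Fin d) ℝ))) =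
        {U | U * star U = 1} := by
      ext U
      exact Matrix.mem_orthogonalGroup_iff (Fin d) ℝ
    rw [this]
    exact isClosed_eq (by fun_prop) continuous_const
  · intro U hU i _ j _
    exact abs_le.mp (entry_norm_bound_of_unitary (𝕜 := ℝ) hU i j)

/-- The Haar probability measure on the orthogonal group `O(d)`. -/
def haarOrthogonal (d : ℕ) : Measure (Matrix.orthogonalGroup (Fin d) ℝ) :=
  Measure.haarMeasure ⊤

/-- The diagonal matrix `D_k` with `k` ones followed by zeros, a point of `𝒢_{k,d}` for `k ≤ d`. -/
def diagProjector {k d : ℕ} (hkd : k ≤ d) : grassmannian k d :=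
  ⟨Matrix.diagonal fun i : Fin d => if (i : ℕ) < k then 1 else 0, by
    refine ⟨Matrix.isSymm_diagonal _, ?_, ?_⟩
    · rw [Matrix.diagonal_mul_diagonal]
      congr 1
      funext i
      split_ifs <;> simp
    · rw [Matrix.trace_diagonal, Finset.sum_boole, Fin.card_filter_val_lt, min_eq_right hkd]⟩

/-- The action `P ↦ U P Uᵀ` of the orthogonal group on `𝒢_{k,d}`. -/
def conj {k d : ℕ} (U : Matrix.orthogonalGroup (Fin d) ℝ) (P : grassmannian k d) :
    grassmannian k d :=
  ⟨(U : Matrix (Fin d) (Fin d) ℝ) * P.1 * (U : Matrix (Fin d) (Fin d) ℝ).transpose, by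
    obtain ⟨U, hU⟩ := U
    obtain ⟨P, hs, hi, ht⟩ := P
    have h : U.transpose * U = 1 := (Matrix.mem_orthogonalGroup_iff' (Fin d) ℝ).mp hU
    refine ⟨?_, ?_, ?_⟩
    · change (U * P * U.transpose).transpose = U * P * U.transpose
      rw [Matrix.transpose_mul, Matrix.transpose_mul, Matrix.transpose_transpose, hs.eq,
        Matrix.mul_assoc]
    · change (U * P * U.transpose) * (U * P * U.transpose) = U * P * U.transpose
      calc (U * P * U.transpose) * (U * P * U.transpose)
          = U * P * (U.transpose * U) * P * U.transpose := by simp only [Matrix.mul_assoc]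
        _ = U * (P * P) * U.transpose := by rw [h, Matrix.mul_one, Matrix.mul_assoc U P P]
        _ = U * P * U.transpose := by rw [hi]
    · change (U * P * U.transpose).trace = k
      rw [Matrix.mul_assoc, Matrix.trace_mul_comm, Matrix.mul_assoc, h, Matrix.mul_one, ht]⟩

/-- The orthogonally invariant probability measure `σ_{k,d}` on `𝒢_{k,d}`: the image of the
Haar probability measure of `O(d)` under `U ↦ U D_k Uᵀ`. -/
def sigma {k d : ℕ} (hkd : k ≤ d) : Measure (grassmannian k d) :=
  (haarOrthogonal d).map fun U => conj U (diagProjector hkd)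

/-- The space `Pol^ℓ_t(𝒢_{k,d})`: the span of the functions `P ↦ ⟨M, P⟩ ^ s` on `𝒢_{k,d}`, where
`M` is symmetric of rank at most `ℓ`, `s ≤ t`, and `⟨M, P⟩ = trace (M P)`. -/
def Pol (ℓ t k d : ℕ) : Submodule ℝ (grassmannian k d → ℝ) :=
  Submodule.span ℝ {f | ∃ M : Matrix (Fin d) (Fin d) ℝ, M.IsSymm ∧ M.rank ≤ ℓ ∧
    ∃ s : ℕ, s ≤ t ∧ f = fun P => (M * P.1).trace ^ s}

/-- `{(P_j, ω_j)}` is a cubature for `Pol^ℓ_t(𝒢_{k,d})`. The weights are arbitrary reals. -/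
def IsCubature {k d n : ℕ} (hkd : k ≤ d) (ℓ t : ℕ) (P : Fin n → grassmannian k d)
    (ω : Fin n → ℝ) : Prop :=
  ∀ f ∈ Pol ℓ t k d, ∑ j, ω j * f (P j) = ∫ Q, f Q ∂(sigma hkd)

/-- The monomial `x ^ α = x_1 ^ α_1 ⋯ x_d ^ α_d`. -/
def monomial {d : ℕ} (α : Fin d → ℕ) (x : Fin d → ℝ) : ℝ :=
  ∏ i, x i ^ α i

end

end MomentFusion

namespace MomentFusion

open Finset

/-! A `sigma`-random projector is `u uᵀ`, with `u` the first column of a Haar orthogonal matrix, so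
for `|β| = t` the monomial of `Q x = ⟨u, x⟩ u` is `⟨u, x⟩ ^ t * u ^ β`. Averaging and expanding `⟨u,
x⟩ ^ t` turns the vector of averages into the Gram matrix of the degree-`t` monomials on the sphere,
applied to the multinomially weighted monomials of `x`. That matrix is invertible, so `x ^ α` is a
combination of the averages with coefficients independent of `x`
(`exists_monomial_eq_sum_integral`). The cubature replaces each average by a weighted sum, because
`Q ↦ (Q x) ^ β` lies in `Pol` (`monomial_mulVec_mem_Pol`): it is, up to a nonzero factor, a
coefficient in `y` of `⟨y, Q x⟩ ^ t`. The resulting identity, pointwise in `x`, is then integrated.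
-/

lemma monomial_smul {d : ℕ} (β : Fin d → ℕ) (r : ℝ) (x : Fin d → ℝ) :
    monomial β (fun i => r * x i) = r ^ (∑ i, β i) * monomial β x := by
  simp only [monomial, mul_pow, Finset.prod_mul_distrib, Finset.prod_pow_eq_pow_sum]

/-- The multinomial expansion of a power of the standard bilinear form. -/
lemma dotProduct_pow_eq_sum {d : ℕ} (t : ℕ) (x y : Fin d → ℝ) :
    (∑ i, x i * y i) ^ t = ∑ γ ∈ piAntidiag univ t,
      (Nat.multinomial univ γ : ℝ) * (monomial γ x * monomial γ y) := by
  rw [Finset.sum_pow_eq_sum_piAntidiag]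
  simp only [monomial, mul_pow, Finset.prod_mul_distrib]

/-- Monomial functions are linearly independent. -/
lemma eq_zero_of_sum_monomial_eq_zero {d : ℕ} (S : Finset (Fin d → ℕ)) (c : (Fin d → ℕ) → ℝ)
    (h : ∀ x : Fin d → ℝ, ∑ γ ∈ S, c γ * monomial γ x = 0) : ∀ γ ∈ S, c γ = 0 := by
  intro γ hγ
  have h0 : (∑ δ ∈ S, MvPolynomial.monomial (Finsupp.equivFunOnFinite.symm δ) (c δ) :
      MvPolynomial (Fin d) ℝ) = 0 := by
    apply MvPolynomial.funext
    intro x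
    rw [map_zero, map_sum, ← h x]
    refine Finset.sum_congr rfl fun δ _ => ?_
    rw [MvPolynomial.eval_monomial, Finsupp.prod_fintype _ _ fun _ => pow_zero _]
    rfl
  have h1 := congrArg (MvPolynomial.coeff (Finsupp.equivFunOnFinite.symm γ)) h0
  rw [MvPolynomial.coeff_sum, MvPolynomial.coeff_zero, Finset.sum_eq_single γ] at h1
  · simpa using h1
  · intro δ _ hδ
    rw [MvPolynomial.coeff_monomial, if_neg]
    exact fun he => hδ (Finsupp.equivFunOnFinite.symm.injective he)
  · exact fun hn => absurd hγ hn

/-- If all values of a vector-valued polynomial lie in a subspace, so do its coefficients. -/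
lemma mem_of_forall_sum_monomial_smul_mem {d : ℕ} {V : Type*} [AddCommGroup V] [Module ℝ V]
    (W : Submodule ℝ V) (S : Finset (Fin d → ℕ)) (f : (Fin d → ℕ) → V)
    (h : ∀ y : Fin d → ℝ, ∑ γ ∈ S, monomial γ y • f γ ∈ W) : ∀ γ ∈ S, f γ ∈ W := by
  intro γ hγ
  by_contra hn
  -- A functional vanishing on `W` but not at `f γ` reduces the claim to real coefficients.
  obtain ⟨φ, hφ, hW⟩ := Submodule.exists_le_ker_of_notMem hn
  refine hφ (eq_zero_of_sum_monomial_eq_zero S (fun δ => φ (f δ)) (fun y => ?_) γ hγ)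
  have := hW (h y)
  rw [LinearMap.mem_ker, map_sum] at this
  rw [← this]
  exact Finset.sum_congr rfl fun δ _ => by rw [map_smul, smul_eq_mul, mul_comm]

lemma trace_vecMulVec_mul {d : ℕ} (x y : Fin d → ℝ) (Q : Matrix (Fin d) (Fin d) ℝ) :
    (Matrix.vecMulVec x y * Q).trace = ∑ i, y i * Q.mulVec x i := by
  rw [Matrix.vecMulVec_mul, Matrix.trace_vecMulVec, dotProduct_comm, ← Matrix.dotProduct_mulVec]
  rfl

lemma matrix_rank_add_le {d : ℕ} (A B : Matrix (Fin d) (Fin d) ℝ) :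
    (A + B).rank ≤ A.rank + B.rank := by
  have h : (A + B).rank = Module.finrank ℝ (LinearMap.range (A.mulVecLin + B.mulVecLin)) := by
    rw [← Matrix.mulVecLin_add, Matrix.rank]
  rw [h]
  exact (Submodule.finrank_mono (LinearMap.range_add_le _ _)).trans
    (Submodule.finrank_add_le_finrank_add_finrank _ _)

/-- `Q ↦ ⟨y, Q x⟩ ^ t` is a power of the pairing with a symmetric matrix of rank at most two. -/
lemma sum_mul_mulVec_pow_mem_Pol {k d t ℓ : ℕ} (hℓ : 2 ≤ ℓ) (x y : Fin d → ℝ) :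
    (fun Q : grassmannian k d => (∑ i, y i * Q.1.mulVec x i) ^ t) ∈ Pol ℓ t k d := by
  -- The symmetric part of `x yᵀ` has the same trace pairing with the symmetric matrix `Q` as `x yᵀ`
  -- itself.
  refine Submodule.subset_span ⟨Matrix.vecMulVec ((1 / 2 : ℝ) • x) y +
    Matrix.vecMulVec y ((1 / 2 : ℝ) • x), ?_, ?_, t, le_rfl, ?_⟩
  · rw [Matrix.IsSymm, Matrix.transpose_add, Matrix.transpose_vecMulVec,
      Matrix.transpose_vecMulVec, add_comm]
  · have h1 := Matrix.rank_vecMulVec_le ((1 / 2 : ℝ) • x) y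
    have h2 := Matrix.rank_vecMulVec_le y ((1 / 2 : ℝ) • x)
    exact ((matrix_rank_add_le _ _).trans (add_le_add h1 h2)).trans hℓ
  · funext Q
    have hs : (Matrix.vecMulVec y x * Q.1).trace = (Matrix.vecMulVec x y * Q.1).trace := by
      rw [← Matrix.trace_transpose, Matrix.transpose_mul, Matrix.transpose_vecMulVec, Q.2.1.eq,
        Matrix.trace_mul_comm]
    rw [add_mul, Matrix.trace_add, Matrix.smul_vecMulVec, Matrix.vecMulVec_smul, smul_mul_assoc,
      smul_mul_assoc, Matrix.trace_smul, Matrix.trace_smul, hs, ← smul_add, ← two_smul ℝ,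
      smul_smul, trace_vecMulVec_mul]
    norm_num

/-- The monomials of degree `t` of the projected vector `Q x` belong to `Pol`. -/
lemma monomial_mulVec_mem_Pol {k d t ℓ : ℕ} (hℓ : 2 ≤ ℓ) (x : Fin d → ℝ) (β : Fin d → ℕ)
    (hβ : ∑ i, β i = t) :
    (fun Q : grassmannian k d => monomial β (Q.1.mulVec x)) ∈ Pol ℓ t k d := by
  have key := mem_of_forall_sum_monomial_smul_mem (Pol ℓ t k d) (piAntidiag univ t)
    (fun γ => (Nat.multinomial univ γ : ℝ) •
      fun Q : grassmannian k d => monomial γ (Q.1.mulVec x)) (fun y => by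
      convert sum_mul_mulVec_pow_mem_Pol (k := k) (t := t) hℓ x y using 1
      funext Q
      rw [dotProduct_pow_eq_sum, Finset.sum_apply]
      refine Finset.sum_congr rfl fun γ _ => ?_
      simp only [Pi.smul_apply, smul_eq_mul]
      ring) β (by simp [hβ])
  have hm : (Nat.multinomial univ β : ℝ) ≠ 0 := by
    exact_mod_cast (Nat.multinomial_pos univ β).ne'
  exact ((Pol ℓ t k d).smul_mem_iff hm).mp key

/-- The first column of an orthogonal matrix. -/
def firstColumn {d : ℕ} (hd : 1 ≤ d) (U : Matrix.orthogonalGroup (Fin d) ℝ) : Fin d → ℝ :=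
  fun i => U.1 i ⟨0, hd⟩

/-- `U D₁ Uᵀ = u uᵀ` for the first column `u` of `U`. -/
lemma conj_diagProjector_mulVec {d : ℕ} (hd : 1 ≤ d) (U : Matrix.orthogonalGroup (Fin d) ℝ)
    (x : Fin d → ℝ) :
    (conj U (diagProjector hd)).1.mulVec x =
      fun i => (∑ j, firstColumn hd U j * x j) * firstColumn hd U i := by
  funext i
  have hD : (Matrix.diagonal fun i : Fin d => if (i : ℕ) < 1 then (1 : ℝ) else 0) =
      Matrix.diagonal (Pi.single ⟨0, hd⟩ 1) := by
    congr 1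
    funext i
    simp [Pi.single_apply, Fin.ext_iff]
  simp only [conj, diagProjector, hD]
  rw [← Matrix.mulVec_mulVec, ← Matrix.mulVec_mulVec, mul_comm]
  rw [Matrix.mulVec, dotProduct, Finset.sum_eq_single (⟨0, hd⟩ : Fin d)]
  · rw [Matrix.mulVec_diagonal, Pi.single_eq_same, one_mul]
    rfl
  · intro j _ hj
    rw [Matrix.mulVec_diagonal, Pi.single_eq_of_ne hj, zero_mul, mul_zero]
  · simp

instance isHaarMeasure_haarOrthogonal (d : ℕ) : (haarOrthogonal d).IsHaarMeasure := by
  unfold haarOrthogonal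
  infer_instance

lemma continuous_conj {k d : ℕ} (Q : grassmannian k d) :
    Continuous fun U : Matrix.orthogonalGroup (Fin d) ℝ => conj U Q := by
  refine Continuous.subtype_mk ?_ _
  fun_prop

lemma continuous_monomial {d : ℕ} (β : Fin d → ℕ) : Continuous (monomial β) := by
  unfold monomial
  fun_prop

/-- Every vector is a multiple of the first column of an orthogonal matrix. -/
lemma exists_orthogonal_column {d : ℕ} (hd : 1 ≤ d) (x : Fin d → ℝ) :
    ∃ (U : Matrix.orthogonalGroup (Fin d) ℝ) (r : ℝ),
      x = fun i => r * firstColumn hd U i := by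
  by_cases hx : x = 0
  · exact ⟨1, 0, by funext i; simp [hx]⟩
  set z : EuclideanSpace ℝ (Fin d) := WithLp.toLp 2 x with hz
  have hz0 : z ≠ 0 := fun h => hx (by simpa [hz] using h)
  have hn : ‖z‖ ≠ 0 := norm_ne_zero_iff.mpr hz0
  -- The family is constant, but only its value at index `0` is prescribed for the basis.
  obtain ⟨b, hb⟩ := Orthonormal.exists_orthonormalBasis_extension_of_card_eq (𝕜 := ℝ)
    (E := EuclideanSpace ℝ (Fin d)) (ι := Fin d) (by simp) (v := fun _ => (‖z‖⁻¹ : ℝ) • z)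
    (s := {⟨0, hd⟩}) (by
      refine ⟨fun i => ?_, fun i j hij => absurd (Subsingleton.elim i j) hij⟩
      simp [norm_smul, hn])
  refine ⟨⟨_, (EuclideanSpace.basisFun (Fin d) ℝ).toMatrix_orthonormalBasis_mem_orthogonal b⟩,
    ‖z‖, ?_⟩
  funext i
  have := hb ⟨0, hd⟩ rfl
  simp [firstColumn, Module.Basis.toMatrix_apply, this, hz]
  rw [mul_inv_cancel_left₀]
  exact hn

lemma continuous_firstColumn {d : ℕ} (hd : 1 ≤ d) : Continuous (firstColumn hd) :=
  continuous_pi fun i => Continuous.matrix_elem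
    (A := fun U : Matrix.orthogonalGroup (Fin d) ℝ => U.1) continuous_subtype_val i ⟨0, hd⟩

lemma integrable_haarOrthogonal {d : ℕ} {f : Matrix.orthogonalGroup (Fin d) ℝ → ℝ}
    (hf : Continuous f) : Integrable f (haarOrthogonal d) :=
  hf.integrable_of_hasCompactSupport (HasCompactSupport.of_compactSpace f)

lemma integrable_monomial_mul_monomial_firstColumn {d : ℕ} (hd : 1 ≤ d) (γ β : Fin d → ℕ) :
    Integrable (fun U => monomial γ (firstColumn hd U) * monomial β (firstColumn hd U))
      (haarOrthogonal d) :=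
  integrable_haarOrthogonal (((continuous_monomial γ).comp (continuous_firstColumn hd)).mul
    ((continuous_monomial β).comp (continuous_firstColumn hd)))

/-- The Gram matrix of the monomials with respect to the invariant measure on the sphere. -/
noncomputable def sphereGram {d : ℕ} (hd : 1 ≤ d) (t : ℕ) :
    Matrix (piAntidiag (univ : Finset (Fin d)) t) (piAntidiag (univ : Finset (Fin d)) t) ℝ :=
  fun γ β => ∫ U, monomial γ.1 (firstColumn hd U) * monomial β.1 (firstColumn hd U)
    ∂(haarOrthogonal d)

/-- A homogeneous polynomial that vanishes on the sphere is zero. -/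
lemma eq_zero_of_sum_monomial_firstColumn_eq_zero {d t : ℕ} (hd : 1 ≤ d)
    (c : piAntidiag (univ : Finset (Fin d)) t → ℝ)
    (h : ∀ U, ∑ γ, c γ * monomial γ.1 (firstColumn hd U) = 0) : c = 0 := by
  have key := eq_zero_of_sum_monomial_eq_zero (piAntidiag univ t)
    (fun γ => if hγ : γ ∈ piAntidiag univ t then c ⟨γ, hγ⟩ else 0) (fun x => by
      -- By homogeneity, the value at `r • u` is `r ^ t` times the value at `u`, which is zero.
      obtain ⟨U, r, rfl⟩ := exists_orthogonal_column hd x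
      rw [← Finset.sum_coe_sort, ← mul_zero (r ^ t), ← h U, Finset.mul_sum]
      refine Finset.sum_congr rfl fun γ _ => ?_
      have hγ : ∑ i, γ.1 i = t := (mem_piAntidiag.mp γ.2).1
      rw [dif_pos γ.2, monomial_smul, hγ]
      ring)
  funext γ
  simpa using key γ.1 γ.2

/-- If `G c = 0`, then `cᵀ G c`, the integral of the square of the polynomial with coefficients `c`,
vanishes. -/
lemma sphereGram_mulVec_injective {d : ℕ} (hd : 1 ≤ d) (t : ℕ) :
    Function.Injective (sphereGram hd t).mulVecLin := by
  rw [injective_iff_map_eq_zero]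
  intro c hc
  apply eq_zero_of_sum_monomial_firstColumn_eq_zero hd c
  have hq : Continuous fun U => ∑ γ, c γ * monomial γ.1 (firstColumn hd U) :=
    continuous_finsetSum _ fun γ _ =>
      continuous_const.mul ((continuous_monomial γ.1).comp (continuous_firstColumn hd))
  have h0 : ∫ U, (∑ γ, c γ * monomial γ.1 (firstColumn hd U)) ^ 2 ∂(haarOrthogonal d) = 0 := by
    calc _ = ∫ U, ∑ γ, ∑ β, c γ * c β * (monomial γ.1 (firstColumn hd U) *
          monomial β.1 (firstColumn hd U)) ∂(haarOrthogonal d) := by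
          congr 1
          funext U
          rw [sq, Finset.sum_mul_sum]
          exact Finset.sum_congr rfl fun γ _ => Finset.sum_congr rfl fun β _ => by ring
      _ = ∑ γ, c γ * (sphereGram hd t).mulVecLin c γ := by
          rw [integral_finsetSum _ fun γ _ => integrable_finsetSum _ fun β _ =>
            (integrable_monomial_mul_monomial_firstColumn hd γ.1 β.1).const_mul _]
          refine Finset.sum_congr rfl fun γ _ => ?_
          rw [integral_finsetSum _ fun β _ =>
            (integrable_monomial_mul_monomial_firstColumn hd γ.1 β.1).const_mul _,
            Matrix.mulVecLin_apply, Matrix.mulVec, dotProduct, Finset.mul_sum]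
          refine Finset.sum_congr rfl fun β _ => ?_
          rw [integral_const_mul, sphereGram]
          ring
      _ = 0 := by simp [hc]
  have h1 := (integral_eq_zero_iff_of_nonneg (fun U => sq_nonneg _)
    (integrable_haarOrthogonal (hq.pow 2))).mp h0
  -- Haar measure charges every nonempty open set, so a continuous function that is zero a.e. is
  -- zero everywhere.
  have h2 := (hq.pow 2).ae_eq_iff_eq (haarOrthogonal d) continuous_const |>.mp h1
  intro U
  exact pow_eq_zero_iff two_ne_zero |>.mp (congrFun h2 U)

lemma integral_monomial_mulVec_sigma {d t : ℕ} (hd : 1 ≤ d) (β : Fin d → ℕ)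
    (hβ : β ∈ piAntidiag univ t) (x : Fin d → ℝ) :
    ∫ Q, monomial β (Q.1.mulVec x) ∂(sigma hd) =
      ∑ γ : piAntidiag (univ : Finset (Fin d)) t,
        (Nat.multinomial univ γ.1 : ℝ) * monomial γ.1 x * sphereGram hd t γ ⟨β, hβ⟩ := by
  have hcont : Continuous fun Q : grassmannian 1 d => monomial β (Q.1.mulVec x) :=
    (continuous_monomial β).comp (continuous_subtype_val.matrix_mulVec continuous_const)
  rw [sigma, integral_map (continuous_conj _).measurable.aemeasurable
    hcont.aestronglyMeasurable]
  have hU : ∀ U, monomial β ((conj U (diagProjector hd)).1.mulVec x) =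
      ∑ γ : piAntidiag (univ : Finset (Fin d)) t,
        (Nat.multinomial univ γ.1 : ℝ) * monomial γ.1 x *
          (monomial γ.1 (firstColumn hd U) * monomial β (firstColumn hd U)) := fun U => by
    rw [conj_diagProjector_mulVec, monomial_smul, (mem_piAntidiag.mp hβ).1,
      dotProduct_pow_eq_sum, Finset.sum_mul, ← Finset.sum_coe_sort]
    refine Finset.sum_congr rfl fun γ _ => ?_
    ring
  simp only [hU]
  rw [integral_finsetSum _ fun γ _ =>
    (integrable_monomial_mul_monomial_firstColumn hd γ.1 β).const_mul _]
  exact Finset.sum_congr rfl fun γ _ => integral_const_mul _ _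

/-- Every monomial is a linear combination of the averaged projected monomials. -/
lemma exists_monomial_eq_sum_integral {d t : ℕ} (hd : 1 ≤ d) (α : Fin d → ℕ)
    (hα : ∑ i, α i = t) :
    ∃ a : (Fin d → ℕ) → ℝ, ∀ x : Fin d → ℝ, monomial α x =
      ∑ β ∈ piAntidiag univ t, a β * ∫ Q, monomial β (Q.1.mulVec x) ∂(sigma hd) := by
  have hmem : α ∈ piAntidiag univ t := by simp [hα]
  have hm : (Nat.multinomial univ α : ℝ) ≠ 0 := by
    exact_mod_cast (Nat.multinomial_pos univ α).ne'
  -- The target isolates `α` and cancels its multinomial weight.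
  obtain ⟨c, hc⟩ := LinearMap.injective_iff_surjective.mp (sphereGram_mulVec_injective hd t)
    (Pi.single ⟨α, hmem⟩ (Nat.multinomial univ α : ℝ)⁻¹)
  refine ⟨fun β => if hβ : β ∈ piAntidiag univ t then c ⟨β, hβ⟩ else 0, fun x => ?_⟩
  rw [← Finset.sum_coe_sort]
  calc monomial α x
      = ∑ γ : piAntidiag (univ : Finset (Fin d)) t, (Nat.multinomial univ γ.1 : ℝ) *
          monomial γ.1 x * (sphereGram hd t).mulVecLin c γ := by
        rw [hc, Finset.sum_eq_single ⟨α, hmem⟩]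
        · rw [Pi.single_eq_same]
          field_simp
        · intro γ _ hγ
          rw [Pi.single_eq_of_ne hγ, mul_zero]
        · simp
    _ = ∑ β : piAntidiag (univ : Finset (Fin d)) t, c β *
          ∫ Q, monomial β.1 (Q.1.mulVec x) ∂(sigma hd) := by
        simp only [fun β : piAntidiag (univ : Finset (Fin d)) t =>
          integral_monomial_mulVec_sigma hd β.1 β.2 x, Matrix.mulVecLin_apply, Matrix.mulVec,
          dotProduct, Finset.mul_sum]
        rw [Finset.sum_comm]
        exact Finset.sum_congr rfl fun β _ => Finset.sum_congr rfl fun γ _ => by ring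
    _ = _ := Finset.sum_congr rfl fun β _ => by simp only [β.2, dite_true, Subtype.coe_eta]

end MomentFusion

theorem corollary3p4 {d t n : ℕ} (hd : 1 ≤ d) (htd : t ≤ d)
    (P : Fin n → MomentFusion.grassmannian 1 d) (ω : Fin n → ℝ)
    (hP : MomentFusion.IsCubature hd 3 t P ω)
    (α : Fin d → ℕ) (hα : ∑ i, α i = t) :
    ∃ a : (Fin d → ℕ) → ℝ,
      ∀ {Ω : Type*} [MeasurableSpace Ω] (μ : Measure Ω) [IsProbabilityMeasure μ]
        (X : Ω → Fin d → ℝ), Measurable X →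
        (∀ j : Fin n, ∀ β : Fin d → ℕ, ∑ i, β i = t →
          Integrable (fun w => MomentFusion.monomial β ((P j).1.mulVec (X w))) μ) →
        Integrable (fun w => MomentFusion.monomial α (X w)) μ ∧
          ∫ w, MomentFusion.monomial α (X w) ∂μ =
            ∑ β ∈ Finset.piAntidiag (Finset.univ : Finset (Fin d)) t,
              a β * ∑ j, ω j *
                ∫ w, MomentFusion.monomial β ((P j).1.mulVec (X w)) ∂μ := by
  -- These coefficients are fixed without reference to `P`, `ω` or `X`.
  obtain ⟨a, ha⟩ := MomentFusion.exists_monomial_eq_sum_integral hd α hα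
  refine ⟨a, fun μ _ X _ hX => ?_⟩
  have hpt : ∀ x : Fin d → ℝ, MomentFusion.monomial α x =
      ∑ β ∈ Finset.piAntidiag (Finset.univ : Finset (Fin d)) t,
        a β * ∑ j, ω j * MomentFusion.monomial β ((P j).1.mulVec x) := fun x => by
    rw [ha x]
    refine Finset.sum_congr rfl fun β hβ => ?_
    rw [hP _ (MomentFusion.monomial_mulVec_mem_Pol (by norm_num) x β
      (Finset.mem_piAntidiag.mp hβ).1)]
  have hint : ∀ β ∈ Finset.piAntidiag (Finset.univ : Finset (Fin d)) t, ∀ j,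
      Integrable (fun w => ω j * MomentFusion.monomial β ((P j).1.mulVec (X w))) μ :=
    fun β hβ j => (hX j β (Finset.mem_piAntidiag.mp hβ).1).const_mul _
  have hint' : ∀ β ∈ Finset.piAntidiag (Finset.univ : Finset (Fin d)) t,
      Integrable (fun w => a β *
        ∑ j, ω j * MomentFusion.monomial β ((P j).1.mulVec (X w))) μ :=
    fun β hβ => (integrable_finsetSum _ fun j _ => hint β hβ j).const_mul _
  simp only [hpt (X _)]
  refine ⟨integrable_finsetSum _ hint', ?_⟩
  rw [integral_finsetSum _ hint']
  refine Finset.sum_congr rfl fun β hβ => ?_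
  rw [integral_const_mul, integral_finsetSum _ fun j _ => hint β hβ j]
  simp only [integral_const_mul]
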